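/- Let $K$ be an algebraically closed field of characteristic zero, let $f(X)\in K[X]$ with $\deg f>1$, and let $\varphi(X,Z)=Z^d+b_{d-1}(X)Z^{d-1}+\dots+b_0(X)\in K[X][Z]$ be monic in $Z$ of degree $d>1$. Put $$B=K[X,Y,Z]/\bigl(f(X)Y-\varphi(X,Z)\bigr)$$ and let $x,y,z$ be the images of $X,Y,Z$ in $B$. The derivation of $K[X,Y,Z]$ over $K$ with $X\mapsto 0$, $Y\mapsto \varphi_Z(X,Z)$, $Z\mapsto f(X)$ (where $\varphi_Z=\partial\varphi/\partial Z$) induces a $K$-derivation $\mathcal D$ of $B$ with $\mathcal D(x)=0$, $\mathcal D(y)=\varphi_Z(x,z)$, $\mathcal D(z)=f(x)$. Let $\operatorname{LND}(B)$ be the set of all nonzero locally nilpotent derivations of the ring $B$, that is, the derivations $D\neq 0$ of $B$ such that for every $a\in B$ there is $n\in\mathbb N$ with $D^n(a)=0$. Then $$\operatorname{LND}(B)=\{\,h\mathcal D \mid h\in K[x],\ h\neq 0\,\}.$$ In particular, $\ker D=K[x]$ for every $D\in\operatorname{LND}(B)$. -/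

import Mathlib

open Polynomial

noncomputable section

/-- `LND(A)`: the set of nonzero locally nilpotent derivations of the commutative ring `A`
(additive maps satisfying the Leibniz rule, with no linearity over a base field required). -/
def LND (A : Type*) [CommRing A] : Set (Derivation ℤ A A) :=
  {D | D ≠ 0 ∧ ∀ a : A, ∃ n : ℕ, (⇑D)^[n] a = 0}

/-- The kernel of a derivation. -/
def derivationKer {A : Type*} [CommRing A] (D : Derivation ℤ A A) : Set A := {a | D a = 0}

namespace Danielewski

variable {K : Type*} [Field K]

/-- The defining polynomial `f(X) Y - φ(X, Z)` in `K[X, Y, Z]`, where the variables `X`, `Y`, `Z`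
are numbered `0`, `1`, `2`. A polynomial `φ ∈ K[X][Z]` is an element of `K[X][X]`, whose outer
variable is `Z`. -/
def equation (f : K[X]) (φ : K[X][X]) : MvPolynomial (Fin 3) K :=
  aeval (MvPolynomial.X 0) f * MvPolynomial.X 1
    - aevalAeval (MvPolynomial.X 0) (MvPolynomial.X 2) φ

/-- The ring `B = K[X, Y, Z] / (f(X) Y - φ(X, Z))`. -/
abbrev B (f : K[X]) (φ : K[X][X]) : Type _ :=
  MvPolynomial (Fin 3) K ⧸ Ideal.span {equation f φ}

/-- The image of `X` in `B`. -/
def x (f : K[X]) (φ : K[X][X]) : B f φ := Ideal.Quotient.mk _ (MvPolynomial.X 0)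

/-- The image of `Y` in `B`. -/
def y (f : K[X]) (φ : K[X][X]) : B f φ := Ideal.Quotient.mk _ (MvPolynomial.X 1)

/-- The image of `Z` in `B`. -/
def z (f : K[X]) (φ : K[X][X]) : B f φ := Ideal.Quotient.mk _ (MvPolynomial.X 2)

/-- The derivation `d` of `K[X, Y, Z]` with `d X = 0`, `d Y = φ_Z(X, Z)`, `d Z = f(X)`. -/
def polyDer (f : K[X]) (φ : K[X][X]) :
    Derivation K (MvPolynomial (Fin 3) K) (MvPolynomial (Fin 3) K) :=
  MvPolynomial.mkDerivation K
    ![0, aevalAeval (MvPolynomial.X 0) (MvPolynomial.X 2) (derivative φ),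
      aeval (MvPolynomial.X 0) f]

theorem derivation_aevalAeval {A : Type*} [CommRing A] [Algebra K A] (D : Derivation K A A)
    (a b : A) (ha : D a = 0) (φ : K[X][X]) :
    D (aevalAeval a b φ) = aevalAeval a b (derivative φ) * D b := by
  have hC : ∀ p : K[X], aevalAeval a b (C p) = aeval a p := by
    intro p
    simp
  have hX : aevalAeval a b (X : K[X][X]) = b := by
    simp
  induction φ using Polynomial.induction_on' with
  | add p q hp hq => simp only [map_add, hp, hq, add_mul]
  | monomial n p =>
    rw [← C_mul_X_pow_eq_monomial, derivative_C_mul_X_pow]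
    simp only [map_mul, map_pow, hC, hX, Derivation.leibniz, Derivation.leibniz_pow,
      Derivation.map_aeval, ha, map_natCast, smul_eq_mul, nsmul_eq_mul]
    ring

theorem polyDer_equation (f : K[X]) (φ : K[X][X]) : polyDer f φ (equation f φ) = 0 := by
  have h0 : polyDer f φ (MvPolynomial.X 0) = 0 := by
    simp [polyDer, MvPolynomial.mkDerivation_X]
  rw [equation, map_sub, Derivation.leibniz, derivation_aevalAeval _ _ _ h0,
    Derivation.map_aeval, h0]
  simp only [polyDer, MvPolynomial.mkDerivation_X, smul_eq_mul]
  simp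
  ring

theorem polyDer_mem (f : K[X]) (φ : K[X][X]) (p : MvPolynomial (Fin 3) K)
    (hp : Ideal.Quotient.mkₐ K (Ideal.span {equation f φ}) p = 0) :
    Ideal.Quotient.mkₐ K (Ideal.span {equation f φ}) (polyDer f φ p) = 0 := by
  rw [Ideal.Quotient.mkₐ_eq_mk, Ideal.Quotient.eq_zero_iff_mem, Ideal.mem_span_singleton] at *
  obtain ⟨q, rfl⟩ := hp
  rw [Derivation.leibniz, polyDer_equation, smul_zero, add_zero, smul_eq_mul]
  exact dvd_mul_right _ _

/-- The derivation `𝒟` of `B` induced by `d`. -/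
def 𝒟 (f : K[X]) (φ : K[X][X]) : Derivation K (B f φ) (B f φ) :=
  Derivation.liftOfSurjective (f := Ideal.Quotient.mkₐ K (Ideal.span {equation f φ}))
    (Ideal.Quotient.mkₐ_surjective K _) (d := polyDer f φ) (polyDer_mem f φ)

end Danielewski

end

/-! Write m = deg f and d = deg φ in Z. Since f(x) is invertible in K(x), B embeds in a field of
Hahn series over K with exponents in ℤ × ℤ, ordered lexicographically, with y = φ/f. The leading
exponent records minus the z-degree, then minus the x-degree. The relation rewrites z^d, so the
monomials x^a y^j z^i with i < d span B; their leading exponents are distinct (`exists_leading`), so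
leading terms never cancel and every nonzero element has the leading exponent of a monomial.

A locally nilpotent D kills the units, hence is K-linear. Let T be its least shift of exponents on x
and z, and let A, C be the coefficients of D x, D z at that shift, not both zero. On leading terms D
acts as a homogeneous derivation: exponent s goes to s + T, multiplied by an additive weight of s
(`gradedRel_of_hasLeadingTerm`). Nilpotency forces weight(s) + j weight(T) = 0 for some natural j
(`exists_weight_eq_zero`). Applied to x, y and z this gives integer equations which, with m, d ≥ 2
and the shape of the exponent semigroup, force A = 0 (`semigroup_shift`). Then D lowers the z-degree
by one, so D x = 0, D z lies in K[x], and ker D = K[x].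

Finally f(x) D y = φ_Z D z, and comparing coefficients of Z^(d-1) shows that f divides D z
(`dvd_of_apply_z`), so D is a K[x]-multiple of 𝒟. -/

set_option linter.unusedSectionVars false

/-! ### Iterated derivations, units and nilpotent elements. -/

namespace Derivation

variable {R A : Type*} [CommRing R] [CommRing A] [Algebra R A] {D : Derivation R A A}

theorem iterate_zero (D : Derivation R A A) (n : ℕ) : (⇑D)^[n] 0 = 0 :=
  iterate_map_zero D n

theorem iterate_add_eq_zero {a : A} {n : ℕ} (h : (⇑D)^[n] a = 0) (k : ℕ) :
    (⇑D)^[n + k] a = 0 := by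
  rw [add_comm, Function.iterate_add_apply, h, iterate_zero]

/-- The top term of the Leibniz formula for an iterated derivation. -/
theorem iterate_mul_of_iterate_succ_eq_zero (n m : ℕ) (a b : A) (ha : (⇑D)^[n + 1] a = 0)
    (hb : (⇑D)^[m + 1] b = 0) :
    (⇑D)^[n + m + 1] (a * b) = 0 ∧
      (⇑D)^[n + m] (a * b) = (n + m).choose n * ((⇑D)^[n] a * (⇑D)^[m] b) := by
  -- The subtraction is truncated: if n or m is 0, then a or b is 0 and the claim is trivial.
  have left : ∀ (n m : ℕ) (a b : A), (⇑D)^[n] a = 0 → (⇑D)^[m] b = 0 →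
      (⇑D)^[n + m - 1] (a * b) = 0 := by
    intro n m
    induction h : n + m generalizing n m with
    | zero =>
      intro a b ha hb
      obtain rfl : n = 0 := by omega
      simp only [Function.iterate_zero, id] at ha
      simp [ha]
    | succ k ih =>
      intro a b ha hb
      rcases Nat.eq_zero_or_pos n with rfl | hn
      · simp only [Function.iterate_zero, id] at ha
        rw [ha, zero_mul, iterate_zero]
      rcases Nat.eq_zero_or_pos m with rfl | hm
      · simp only [Function.iterate_zero, id] at hb
        rw [hb, mul_zero, iterate_zero]
      obtain ⟨n, rfl⟩ := Nat.exists_eq_succ_of_ne_zero hn.ne'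
      obtain ⟨m, rfl⟩ := Nat.exists_eq_succ_of_ne_zero hm.ne'
      obtain ⟨k, rfl⟩ := Nat.exists_eq_succ_of_ne_zero (show k ≠ 0 by omega)
      have h1 := ih (n + 1) m (by omega) a (D b) ha (by simpa using hb)
      have h2 := ih n (m + 1) (by omega) (D a) b (by simpa using ha) hb
      simp only [Nat.succ_eq_add_one, Nat.add_sub_cancel] at h1 h2 ⊢
      rw [Function.iterate_succ_apply, leibniz, iterate_map_add, smul_eq_mul, smul_eq_mul,
        mul_comm b, h1, h2, add_zero]
  refine ⟨by simpa [add_assoc, add_left_comm] using left _ _ a b ha hb, ?_⟩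
  induction h : n + m generalizing n m a b with
  | zero =>
    obtain ⟨rfl, rfl⟩ : n = 0 ∧ m = 0 := by omega
    simp
  | succ k ih =>
    rw [Function.iterate_succ_apply, leibniz, iterate_map_add, smul_eq_mul, smul_eq_mul,
      mul_comm b]
    rcases Nat.eq_zero_or_pos n with rfl | hn
    · obtain ⟨m, rfl⟩ := Nat.exists_eq_succ_of_ne_zero (show m ≠ 0 by omega)
      obtain rfl : k = m := by omega
      simp only [zero_add, Function.iterate_one] at ha
      rw [ih 0 k a (D b) ha (by simpa using hb) (by omega), ha, zero_mul, iterate_zero]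
      simp
    rcases Nat.eq_zero_or_pos m with rfl | hm
    · obtain ⟨n, rfl⟩ := Nat.exists_eq_succ_of_ne_zero hn.ne'
      obtain rfl : k = n := by omega
      simp only [zero_add, Function.iterate_one] at hb
      rw [ih k 0 (D a) b (by simpa using ha) hb (by omega), hb, mul_zero, iterate_zero]
      simp
    obtain ⟨n, rfl⟩ := Nat.exists_eq_succ_of_ne_zero hn.ne'
    obtain ⟨m, rfl⟩ := Nat.exists_eq_succ_of_ne_zero hm.ne'
    rw [ih (n + 1) m a (D b) ha (by simpa using hb) (by omega),
      ih n (m + 1) (D a) b (by simpa using ha) hb (by omega), Nat.succ_eq_add_one,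
      Nat.choose_succ_succ, Nat.succ_eq_add_one, Function.iterate_succ_apply _ n,
      Function.iterate_succ_apply _ m]
    push_cast
    ring

theorem exists_iterate_ne_zero {a : A} (ha : a ≠ 0) (h : ∃ n : ℕ, (⇑D)^[n] a = 0) :
    ∃ n : ℕ, (⇑D)^[n] a ≠ 0 ∧ (⇑D)^[n + 1] a = 0 := by
  classical
  obtain ⟨n, hn⟩ : ∃ n, Nat.find h = n + 1 := by
    refine Nat.exists_eq_succ_of_ne_zero fun h0 => ha ?_
    simpa [h0] using Nat.find_spec h
  exact ⟨n, Nat.find_min h (by omega), hn ▸ Nat.find_spec h⟩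

/-- A locally nilpotent derivation of a domain of characteristic zero kills the units. -/
theorem apply_eq_zero_of_mul_eq_one [IsDomain A] [CharZero A]
    (hD : ∀ a : A, ∃ n : ℕ, (⇑D)^[n] a = 0) {a b : A} (hab : a * b = 1) : D a = 0 := by
  obtain ⟨n, hn, hn'⟩ := exists_iterate_ne_zero (left_ne_zero_of_mul_eq_one hab) (hD a)
  obtain ⟨m, hm, hm'⟩ := exists_iterate_ne_zero (right_ne_zero_of_mul_eq_one hab) (hD b)
  have h := (iterate_mul_of_iterate_succ_eq_zero n m a b hn' hm').2
  rcases Nat.eq_zero_or_pos n with rfl | hpos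
  · simpa using hn'
  · exfalso
    obtain ⟨k, hk⟩ := Nat.exists_eq_succ_of_ne_zero (show n + m ≠ 0 by omega)
    -- A positive power of D kills ab = 1, while the top Leibniz term is nonzero in a domain of
    -- characteristic zero.
    rw [hab, hk, Function.iterate_succ_apply, map_one_eq_zero, iterate_zero] at h
    refine mul_ne_zero (Nat.cast_ne_zero.2 (Nat.choose_pos ?_).ne') (mul_ne_zero hn hm) h.symm
    omega

/-- The elements on which a derivation acts nilpotently form a subring. -/
def nilSubring (D : Derivation R A A) : Subring A where
  carrier := {a | ∃ n : ℕ, (⇑D)^[n] a = 0}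
  zero_mem' := ⟨0, rfl⟩
  one_mem' := ⟨1, by simp⟩
  neg_mem' := by
    rintro a ⟨n, hn⟩
    exact ⟨n, by rw [iterate_map_neg, hn, neg_zero]⟩
  add_mem' := by
    rintro a b ⟨n, hn⟩ ⟨m, hm⟩
    refine ⟨n + m, ?_⟩
    rw [iterate_map_add, iterate_add_eq_zero hn, add_comm n, iterate_add_eq_zero hm, add_zero]
  mul_mem' := by
    rintro a b ⟨n, hn⟩ ⟨m, hm⟩
    exact ⟨_, (iterate_mul_of_iterate_succ_eq_zero n m a b (iterate_add_eq_zero hn 1)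
      (iterate_add_eq_zero hm 1)).1⟩

theorem mem_nilSubring_of_apply {a : A} (h : D a ∈ nilSubring D) : a ∈ nilSubring D := by
  obtain ⟨n, hn⟩ := h
  exact ⟨n + 1, hn⟩

end Derivation

/-! ### Leading terms of Hahn series. -/

namespace HahnSeries

variable {Γ : Type*} [AddCommGroup Γ] [LinearOrder Γ] [IsOrderedAddMonoid Γ] {K : Type*} [Field K]

/-- `u` has no terms below `g`, and its coefficient at `g` is `c` (which may be zero). -/
def HasLeadingTerm (u : HahnSeries Γ K) (g : Γ) (c : K) : Prop :=
  (∀ h < g, u.coeff h = 0) ∧ u.coeff g = c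

namespace HasLeadingTerm

variable {u v : HahnSeries Γ K} {g h : Γ} {a b : K}

theorem zero (g : Γ) : HasLeadingTerm (0 : HahnSeries Γ K) g 0 := ⟨fun _ _ => rfl, rfl⟩

theorem single (g : Γ) (c : K) : HasLeadingTerm (HahnSeries.single g c) g c :=
  ⟨fun _ hh => coeff_single_of_ne hh.ne, coeff_single_same g c⟩

theorem one : HasLeadingTerm (1 : HahnSeries Γ K) 0 1 := single 0 1

theorem of_ne_zero (_ : u ≠ 0) : HasLeadingTerm u u.order u.leadingCoeff :=
  ⟨fun _ hh => coeff_eq_zero_of_lt_order hh, leadingCoeff_eq.symm⟩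

theorem add (hu : HasLeadingTerm u g a) (hv : HasLeadingTerm v g b) :
    HasLeadingTerm (u + v) g (a + b) :=
  ⟨fun k hk => by rw [coeff_add, hu.1 k hk, hv.1 k hk, add_zero],
    by rw [coeff_add, hu.2, hv.2]⟩

theorem sub (hu : HasLeadingTerm u g a) (hv : HasLeadingTerm v g b) :
    HasLeadingTerm (u - v) g (a - b) :=
  ⟨fun k hk => by rw [coeff_sub, hu.1 k hk, hv.1 k hk, sub_zero],
    by rw [coeff_sub, hu.2, hv.2]⟩

theorem smul (c : K) (hu : HasLeadingTerm u g a) : HasLeadingTerm (c • u) g (c * a) :=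
  ⟨fun k hk => by rw [coeff_smul, hu.1 k hk, smul_zero], by rw [coeff_smul, hu.2, smul_eq_mul]⟩

theorem of_lt (hu : HasLeadingTerm u g a) (hg : h < g) : HasLeadingTerm u h 0 :=
  ⟨fun k hk => hu.1 k (hk.trans hg), hu.1 h hg⟩

theorem unique (hu : HasLeadingTerm u g a) (hv : HasLeadingTerm u g b) : a = b :=
  hu.2.symm.trans hv.2

theorem ne_zero (hu : HasLeadingTerm u g a) (ha : a ≠ 0) : u ≠ 0 := by
  rintro rfl
  exact ha (hu.unique (zero g))

theorem le_of_ne_zero (hu : HasLeadingTerm u g a) (hv : HasLeadingTerm u h b) (hb : b ≠ 0) :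
    g ≤ h := by
  by_contra! hlt
  exact hb (hv.unique (hu.of_lt hlt))

theorem eq_of_ne_zero (hu : HasLeadingTerm u g a) (ha : a ≠ 0) (hv : HasLeadingTerm u h b)
    (hb : b ≠ 0) : g = h :=
  le_antisymm (hu.le_of_ne_zero hv hb) (hv.le_of_ne_zero hu ha)

theorem le_order (hu : HasLeadingTerm u g a) (h0 : u ≠ 0) : g ≤ u.order :=
  hu.le_of_ne_zero (of_ne_zero h0) (leadingCoeff_ne_zero.2 h0)

theorem mul (hu : HasLeadingTerm u g a) (hv : HasLeadingTerm v h b) :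
    HasLeadingTerm (u * v) (g + h) (a * b) := by
  by_cases hu0 : u = 0
  · subst hu0
    rw [hu.unique (zero g), zero_mul, zero_mul]
    exact zero _
  by_cases hv0 : v = 0
  · subst hv0
    rw [hv.unique (zero h), mul_zero, mul_zero]
    exact zero _
  have key : HasLeadingTerm (u * v) (u.order + v.order) (u.leadingCoeff * v.leadingCoeff) := by
    refine ⟨fun k hk => coeff_eq_zero_of_lt_order ?_, coeff_mul_order_add_order u v⟩
    rwa [order_mul hu0 hv0]
  -- If g or h lies strictly below the true order, its coefficient is zero, and so is that of the
  -- product.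
  rcases (hu.le_order hu0).eq_or_lt with rfl | hlt
  · rcases (hv.le_order hv0).eq_or_lt with rfl | hlt
    · rwa [hu.unique (of_ne_zero hu0), hv.unique (of_ne_zero hv0)]
    · rw [hv.unique ((of_ne_zero hv0).of_lt hlt), mul_zero]
      exact key.of_lt (by gcongr)
  · rw [hu.unique ((of_ne_zero hu0).of_lt hlt), zero_mul]
    exact key.of_lt (add_lt_add_of_lt_of_le hlt (hv.le_order hv0))

theorem pow (hu : HasLeadingTerm u g a) (n : ℕ) : HasLeadingTerm (u ^ n) (n • g) (a ^ n) := by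
  induction n with
  | zero => simpa using one
  | succ n ih =>
    rw [pow_succ, pow_succ, succ_nsmul]
    exact ih.mul hu

/-- Division by a series with a known nonzero leading term; it is applied to equations f(x) v = w to
read off y and D y. -/
theorem of_mul (hu : HasLeadingTerm u g a) (ha : a ≠ 0)
    (huv : HasLeadingTerm (u * v) (g + h) b) : HasLeadingTerm v h (a⁻¹ * b) := by
  by_cases hv0 : v = 0
  · subst hv0
    rw [mul_zero] at huv
    rw [huv.unique (zero _), mul_zero]
    exact zero _
  have hv := of_ne_zero hv0
  have key := hu.mul hv
  have hle : h ≤ v.order := by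
    have := huv.le_of_ne_zero key (mul_ne_zero ha (leadingCoeff_ne_zero.2 hv0))
    exact le_of_add_le_add_left this
  rcases hle.eq_or_lt with rfl | hlt
  · rw [huv.unique key, inv_mul_cancel_left₀ ha]
    exact hv
  · rw [huv.unique (key.of_lt (by gcongr)), mul_zero]
    exact hv.of_lt hlt

theorem sum {ι : Type*} (s : Finset ι) (w : ι → HahnSeries Γ K) (c : ι → K)
    (H : ∀ i ∈ s, HasLeadingTerm (w i) g (c i)) :
    HasLeadingTerm (∑ i ∈ s, w i) g (∑ i ∈ s, c i) := by
  classical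
  induction s using Finset.induction_on with
  | empty => simpa using zero g
  | insert i s hi ih =>
    rw [Finset.sum_insert hi, Finset.sum_insert hi]
    exact (H i (Finset.mem_insert_self i s)).add
      (ih fun j hj => H j (Finset.mem_insert_of_mem hj))

end HasLeadingTerm

/-- If the leading exponents of the images of a spanning family are pairwise distinct, then the
leading exponent of the image of `v ≠ 0` is one of them, and `v` is a combination of members of
the family whose leading exponents are not below it. -/
theorem exists_hasLeadingTerm_of_span {V ι : Type*} [AddCommGroup V] [Module K V]
    (ψ : V →ₗ[K] HahnSeries Γ K) (b : ι → V) (o : ι → Γ) (e : ι → K) (he : ∀ i, e i ≠ 0)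
    (ho : Function.Injective o)
    (hb : ∀ i, HasLeadingTerm (ψ (b i)) (o i) (e i)) {v : V}
    (hv : v ∈ Submodule.span K (Set.range b))
    (hv0 : v ≠ 0) :
    ∃ i, ∃ c ≠ 0, HasLeadingTerm (ψ v) (o i) c ∧
      v ∈ Submodule.span K (b '' {j | o i ≤ o j}) := by
  classical
  rw [Finsupp.mem_span_range_iff_exists_finsupp] at hv
  obtain ⟨l, rfl⟩ := hv
  have hne : l.support.Nonempty := by
    rw [Finset.nonempty_iff_ne_empty]
    intro h
    rw [Finsupp.support_eq_empty] at h
    exact hv0 (by simp [h])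
  -- Injectivity of `o` makes the minimum strict, so no other term contributes at that exponent.
  obtain ⟨i, hi, hmin⟩ := Finset.exists_min_image l.support o hne
  refine ⟨i, l i * e i, mul_ne_zero (Finsupp.mem_support_iff.1 hi) (he i), ?_, ?_⟩
  · rw [Finsupp.sum, map_sum, ← Finset.add_sum_erase _ _ hi, ← add_zero (l i * e i)]
    refine HasLeadingTerm.add ?_ ?_
    · rw [map_smul]
      exact (hb i).smul (l i)
    · have := HasLeadingTerm.sum (g := o i) (l.support.erase i) (fun j => ψ (l j • b j))
        (fun _ => 0) (fun j hj => by
          rw [map_smul]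
          exact ((hb j).smul (l j)).of_lt ((hmin j (Finset.mem_of_mem_erase hj)).lt_of_ne
            (ho.ne (Finset.ne_of_mem_erase hj).symm)))
      simpa using this
  · exact Submodule.sum_mem _ fun j hj =>
      Submodule.smul_mem _ _ (Submodule.subset_span ⟨j, hmin j hj, rfl⟩)

end HahnSeries

/-! ### Exponents and the calculus of leading terms. -/

noncomputable section

namespace Danielewski

/-- Exponents: minus the degree in `z`, then minus the degree in `x`. -/
abbrev Expo : Type := ℤ ×ₗ ℤ

/-- The exponent with components `p` and `q`. -/
def expo (p q : ℤ) : Expo := toLex (p, q)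

theorem expo_add (p q p' q' : ℤ) : expo p q + expo p' q' = expo (p + p') (q + q') := rfl

theorem nsmul_expo (n : ℕ) (p q : ℤ) : n • expo p q = expo (n * p) (n * q) := by
  induction n with
  | zero => simp; rfl
  | succ n ih =>
    rw [succ_nsmul, ih, expo_add]
    congr 1 <;> push_cast <;> ring

theorem expo_lt {p q p' q' : ℤ} : expo p q < expo p' q' ↔ p < p' ∨ p = p' ∧ q < q' :=
  Prod.Lex.toLex_lt_toLex

theorem expo_le {p q p' q' : ℤ} : expo p q ≤ expo p' q' ↔ p < p' ∨ p = p' ∧ q ≤ q' :=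
  Prod.Lex.toLex_le_toLex

theorem expo_inj {p q p' q' : ℤ} : expo p q = expo p' q' ↔ p = p' ∧ q = q' := by
  simp [expo]

theorem exists_expo (s : Expo) : ∃ p q, s = expo p q := ⟨(ofLex s).1, (ofLex s).2, rfl⟩

variable {K : Type*} [Field K]

/-- The formal properties of the relation "`a` has leading exponent `s` and leading
coefficient `c`, or only exponents above `s` and `c = 0`". -/
structure IsLeadingRel {A : Type*} [CommRing A] [Algebra K A] (R : A → Expo → K → Prop) :
    Prop where
  algebraMap (c : K) : R (algebraMap K A c) 0 c
  zero (s : Expo) : R 0 s 0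
  add {a b : A} {s : Expo} {c d : K} : R a s c → R b s d → R (a + b) s (c + d)
  mul {a b : A} {s t : Expo} {c d : K} : R a s c → R b t d → R (a * b) (s + t) (c * d)
  of_lt {a : A} {s t : Expo} {c : K} : R a s c → t < s → R a t 0

theorem aevalAeval_eq_sum {A : Type*} [CommRing A] [Algebra K A] (a b : A) (P : K[X][X]) :
    aevalAeval a b P = ∑ i ∈ Finset.range (P.natDegree + 1), aeval a (P.coeff i) * b ^ i := by
  conv_lhs => rw [P.as_sum_range_C_mul_X_pow]
  rw [map_sum]
  refine Finset.sum_congr rfl fun i _ => ?_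
  rw [map_mul, map_pow, aevalAeval_C, aevalAeval_Y]

namespace IsLeadingRel

variable {A : Type*} [CommRing A] [Algebra K A] {R : A → Expo → K → Prop}

theorem pow (hR : IsLeadingRel R) {a : A} {s : Expo} {c : K} (ha : R a s c) (n : ℕ) :
    R (a ^ n) (n • s) (c ^ n) := by
  induction n with
  | zero => simpa using hR.algebraMap 1
  | succ n ih =>
    rw [pow_succ, pow_succ, succ_nsmul]
    exact hR.mul ih ha

theorem sum (hR : IsLeadingRel R) {ι : Type*} {s : Expo} (t : Finset ι) (w : ι → A) (c : ι → K)
    (H : ∀ i ∈ t, R (w i) s (c i)) : R (∑ i ∈ t, w i) s (∑ i ∈ t, c i) := by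
  classical
  induction t using Finset.induction_on with
  | empty => simpa using hR.zero s
  | insert i t hi ih =>
    rw [Finset.sum_insert hi, Finset.sum_insert hi]
    exact hR.add (H i (Finset.mem_insert_self i t))
      (ih fun j hj => H j (Finset.mem_insert_of_mem hj))

theorem smul (hR : IsLeadingRel R) (k : K) {a : A} {s : Expo} {c : K} (ha : R a s c) :
    R (k • a) s (k * c) := by
  rw [Algebra.smul_def, ← zero_add s]
  exact hR.mul (hR.algebraMap k) ha

/-- Only the top-degree term reaches the lowest exponent. The abstract `R` lets this serve both
`HasLeadingTerm` and `GradedRel`. -/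
theorem aeval (hR : IsLeadingRel R) {a : A} (ha : R a (expo 0 (-1)) 1) (g : K[X]) :
    R (aeval a g) (expo 0 (-g.natDegree)) g.leadingCoeff := by
  have hterm : ∀ i, R (g.coeff i • a ^ i) (expo 0 (-i)) (g.coeff i) := by
    intro i
    have := hR.smul (g.coeff i) (hR.pow ha i)
    rw [nsmul_expo] at this
    simpa using this
  rw [aeval_eq_sum_range, Finset.sum_range_succ, ← zero_add g.leadingCoeff]
  refine hR.add ?_ (hterm _)
  have := hR.sum (s := expo 0 (-g.natDegree)) (Finset.range g.natDegree)
    (fun i => g.coeff i • a ^ i) (fun _ => 0) (fun i hi => hR.of_lt (hterm i) (by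
      rw [Finset.mem_range] at hi
      rw [expo_lt]
      omega))
  simpa using this

theorem aevalAeval (hR : IsLeadingRel R) {a b : A} (ha : R a (expo 0 (-1)) 1)
    (hb : R b (expo (-1) 0) 1) (P : K[X][X]) :
    R (aevalAeval a b P) (expo (-P.natDegree) (-P.leadingCoeff.natDegree))
      P.leadingCoeff.leadingCoeff := by
  have hterm : ∀ i, R (Polynomial.aeval a (P.coeff i) * b ^ i)
      (expo (-i) (-(P.coeff i).natDegree)) (P.coeff i).leadingCoeff := by
    intro i
    have := hR.mul (hR.aeval ha (P.coeff i)) (hR.pow hb i)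
    rw [nsmul_expo, expo_add] at this
    simpa using this
  rw [aevalAeval_eq_sum, Finset.sum_range_succ, ← zero_add P.leadingCoeff.leadingCoeff]
  refine hR.add ?_ (hterm _)
  have := hR.sum (s := expo (-P.natDegree) (-P.leadingCoeff.natDegree))
    (Finset.range P.natDegree) (fun i => Polynomial.aeval a (P.coeff i) * b ^ i) (fun _ => 0)
    (fun i hi => hR.of_lt (hterm i) (by
      rw [Finset.mem_range] at hi
      rw [expo_lt]
      omega))
  simpa using this

end IsLeadingRel

open HahnSeries in
theorem isLeadingRel_hasLeadingTerm :
    IsLeadingRel (HasLeadingTerm : HahnSeries Expo K → Expo → K → Prop) where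
  algebraMap c := by
    rw [HahnSeries.algebraMap_apply]
    exact HasLeadingTerm.single 0 c
  zero := HasLeadingTerm.zero
  add := HasLeadingTerm.add
  mul := HasLeadingTerm.mul
  of_lt := HasLeadingTerm.of_lt

theorem map_aevalAeval {A A' : Type*} [CommRing A] [Algebra K A] [CommRing A'] [Algebra K A']
    (g : A →ₐ[K] A') (a b : A) (P : K[X][X]) :
    g (aevalAeval a b P) = aevalAeval (g a) (g b) P := by
  induction P using Polynomial.induction_on' with
  | add p q hp hq => simp only [map_add, hp, hq]
  | monomial n p =>
    rw [← C_mul_X_pow_eq_monomial]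
    simp only [map_mul, map_pow, aevalAeval_C, aevalAeval_Y, aeval_algHom_apply]

/-! ### The embedding of B in Hahn series and the monomial spanning family. -/

section Embedding

variable (f : K[X]) (φ : K[X][X])

theorem aeval_x_mul_y : aeval (x f φ) f * y f φ = aevalAeval (x f φ) (z f φ) φ := by
  have h : Ideal.Quotient.mkₐ K (Ideal.span {equation f φ}) (equation f φ) = 0 := by
    rw [Ideal.Quotient.mkₐ_eq_mk, Ideal.Quotient.eq_zero_iff_mem]
    exact Ideal.mem_span_singleton_self _
  have h' := (congrArg (Ideal.Quotient.mkₐ K (Ideal.span {equation f φ}))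
    (equation.eq_1 f φ)).symm.trans h
  rw [map_sub, map_mul, ← aeval_algHom_apply, map_aevalAeval, sub_eq_zero] at h'
  exact h'

/-- The image of `X` in the field of Hahn series. -/
def hahnX : HahnSeries Expo K := HahnSeries.single (expo 0 (-1)) 1

/-- The image of `Z` in the field of Hahn series. -/
def hahnZ : HahnSeries Expo K := HahnSeries.single (expo (-1) 0) 1

theorem hahnX_leading : (hahnX : HahnSeries Expo K).HasLeadingTerm (expo 0 (-1)) 1 :=
  HahnSeries.HasLeadingTerm.single _ _

theorem hahnZ_leading : (hahnZ : HahnSeries Expo K).HasLeadingTerm (expo (-1) 0) 1 :=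
  HahnSeries.HasLeadingTerm.single _ _

/-- The embedding of `B` into a field of Hahn series. -/
def toHahn (hf : f ≠ 0) : B f φ →ₐ[K] HahnSeries Expo K :=
  Ideal.Quotient.liftₐ _
    (MvPolynomial.aeval ![hahnX, (aeval hahnX f)⁻¹ * aevalAeval hahnX hahnZ φ, hahnZ]) (by
      intro a ha
      rw [Ideal.mem_span_singleton] at ha
      obtain ⟨q, rfl⟩ := ha
      have h0 : aeval (hahnX : HahnSeries Expo K) f ≠ 0 :=
        (isLeadingRel_hasLeadingTerm.aeval hahnX_leading f).ne_zero (leadingCoeff_ne_zero.2 hf)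
      rw [map_mul, equation, map_sub, map_mul, ← aeval_algHom_apply, map_aevalAeval]
      simp only [MvPolynomial.aeval_X]
      simp [mul_inv_cancel_left₀ h0])

variable {f φ}

@[simp] theorem toHahn_x (hf : f ≠ 0) : toHahn f φ hf (x f φ) = hahnX := by
  refine (MvPolynomial.aeval_X _ _).trans ?_
  rfl

@[simp] theorem toHahn_z (hf : f ≠ 0) : toHahn f φ hf (z f φ) = hahnZ := by
  refine (MvPolynomial.aeval_X _ _).trans ?_
  rfl

theorem toHahn_y_leading (hf : f ≠ 0) (hφ : φ.Monic) :
    (toHahn f φ hf (y f φ)).HasLeadingTerm (expo (-φ.natDegree) f.natDegree)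
      f.leadingCoeff⁻¹ := by
  have h := congrArg (toHahn f φ hf) (aeval_x_mul_y f φ)
  rw [map_mul, ← aeval_algHom_apply, map_aevalAeval, toHahn_x, toHahn_z] at h
  have h1 := isLeadingRel_hasLeadingTerm.aeval hahnX_leading f
  have h2 := isLeadingRel_hasLeadingTerm.aevalAeval hahnX_leading hahnZ_leading φ
  rw [← h, hφ.leadingCoeff, natDegree_one] at h2
  rw [← mul_one f.leadingCoeff⁻¹]
  refine h1.of_mul (leadingCoeff_ne_zero.2 hf) (h := expo (-φ.natDegree) f.natDegree) ?_
  rw [expo_add]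
  simpa using h2

variable (f φ) in
/-- The monomials `x ^ a * y ^ j * z ^ i` with `i < d`, indexed by `(a, n)` with `n = d * j + i`. -/
def basisMon (i : ℕ × ℕ) : B f φ :=
  x f φ ^ i.1 * y f φ ^ (i.2 / φ.natDegree) * z f φ ^ (i.2 % φ.natDegree)

variable (f φ) in
/-- The leading exponents of the monomials `basisMon`. -/
def basisExpo (i : ℕ × ℕ) : Expo :=
  expo (-i.2) (f.natDegree * (i.2 / φ.natDegree : ℕ) - i.1)

/-- The first component recovers n, hence both j = n / d and i = n % d; the second then recovers a.
-/
theorem basisExpo_injective : Function.Injective (basisExpo f φ) := by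
  rintro ⟨a, n⟩ ⟨a', n'⟩ h
  rw [basisExpo, basisExpo, expo_inj] at h
  obtain ⟨h1, h2⟩ := h
  obtain rfl : n = n' := by simpa using h1
  simp only [Prod.mk.injEq, and_true]
  simpa using h2

theorem isLeadingRel_basisMon {R : B f φ → Expo → K → Prop} (hR : IsLeadingRel R)
    (hx : R (x f φ) (expo 0 (-1)) 1) (hz : R (z f φ) (expo (-1) 0) 1)
    (hy : R (y f φ) (expo (-φ.natDegree) f.natDegree) f.leadingCoeff⁻¹) (i : ℕ × ℕ) :
    R (basisMon f φ i) (basisExpo f φ i) (f.leadingCoeff⁻¹ ^ (i.2 / φ.natDegree)) := by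
  have h := hR.mul (hR.mul (hR.pow hx i.1) (hR.pow hy (i.2 / φ.natDegree)))
    (hR.pow hz (i.2 % φ.natDegree))
  simp only [nsmul_expo, expo_add, one_pow, one_mul, mul_one] at h
  have he : basisExpo f φ i =
      expo (i.1 * 0 + (i.2 / φ.natDegree : ℕ) * -φ.natDegree + (i.2 % φ.natDegree : ℕ) * -1)
        (i.1 * -1 + (i.2 / φ.natDegree : ℕ) * f.natDegree + (i.2 % φ.natDegree : ℕ) * 0) := by
    unfold basisExpo
    rw [expo_inj]
    constructor
    · have := Nat.div_add_mod i.2 φ.natDegree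
      zify at this
      push_cast
      linear_combination this
    · ring
  rw [he]
  exact h

/-- The span contains 1 and is stable under multiplication by x, y and z. Only multiplication by z
at i = d - 1 needs the relation, which replaces z^d by f(x)y minus lower powers of z. -/
theorem span_basisMon (hφ : φ.Monic) (hd : 0 < φ.natDegree) :
    Submodule.span K (Set.range (basisMon f φ)) = ⊤ := by
  set M := Submodule.span K (Set.range (basisMon f φ)) with hM
  have mem : ∀ a j i : ℕ, i < φ.natDegree → x f φ ^ a * y f φ ^ j * z f φ ^ i ∈ M := by
    intro a j i hi
    refine Submodule.subset_span ⟨(a, φ.natDegree * j + i), ?_⟩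
    simp [basisMon, Nat.mul_add_div hd, Nat.div_eq_of_lt hi, Nat.mod_eq_of_lt hi]
  have stable : ∀ w : B f φ, (∀ a j i : ℕ, i < φ.natDegree →
      x f φ ^ a * y f φ ^ j * z f φ ^ i * w ∈ M) → ∀ b ∈ M, b * w ∈ M := by
    intro w hw b hb
    induction hb using Submodule.span_induction with
    | mem b hb =>
      obtain ⟨i, rfl⟩ := hb
      exact hw _ _ _ (Nat.mod_lt _ hd)
    | zero => simp
    | add b c _ _ hb hc => rw [add_mul]; exact M.add_mem hb hc
    | smul k b _ hb => rw [smul_mul_assoc]; exact M.smul_mem k hb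
  have hx : ∀ b ∈ M, b * x f φ ∈ M := stable _ fun a j i hi => by
    convert mem (a + 1) j i hi using 1
    ring
  have hy : ∀ b ∈ M, b * y f φ ∈ M := stable _ fun a j i hi => by
    convert mem a (j + 1) i hi using 1
    ring
  have hpoly : ∀ (g : K[X]), ∀ b ∈ M, b * aeval (x f φ) g ∈ M := by
    intro g b hb
    induction g using Polynomial.induction_on' with
    | add p q hp hq => rw [map_add, mul_add]; exact M.add_mem hp hq
    | monomial n k =>
      rw [aeval_monomial, mul_left_comm, ← Algebra.smul_def]
      refine M.smul_mem k ?_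
      induction n with
      | zero => simpa using hb
      | succ n ih => rw [pow_succ, ← mul_assoc]; exact hx _ ih
  have hz : ∀ b ∈ M, b * z f φ ∈ M := stable _ fun a j i hi => by
    rcases Nat.lt_or_ge (i + 1) φ.natDegree with h | h
    · convert mem a j (i + 1) h using 1
      ring
    · have hzd : z f φ ^ φ.natDegree = aeval (x f φ) f * y f φ -
          ∑ l ∈ Finset.range φ.natDegree, aeval (x f φ) (φ.coeff l) * z f φ ^ l := by
        rw [aeval_x_mul_y, aevalAeval_eq_sum, Finset.sum_range_succ, coeff_natDegree,
          hφ.leadingCoeff, map_one, one_mul, add_sub_cancel_left]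
      have : x f φ ^ a * y f φ ^ j * z f φ ^ i * z f φ =
          x f φ ^ a * y f φ ^ (j + 1) * z f φ ^ 0 * aeval (x f φ) f -
          ∑ l ∈ Finset.range φ.natDegree,
            x f φ ^ a * y f φ ^ j * z f φ ^ l * aeval (x f φ) (φ.coeff l) := by
        rw [mul_assoc, ← pow_succ, show i + 1 = φ.natDegree by omega, hzd, mul_sub,
          Finset.mul_sum]
        congr 1
        · ring
        · exact Finset.sum_congr rfl fun l _ => by ring
      rw [this]
      exact M.sub_mem (hpoly _ _ (mem _ _ _ hd)) (Submodule.sum_mem _ fun l hl =>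
        hpoly _ _ (mem _ _ _ (Finset.mem_range.1 hl)))
  rw [eq_top_iff]
  rintro b -
  obtain ⟨p, rfl⟩ := Ideal.Quotient.mk_surjective b
  induction p using MvPolynomial.induction_on with
  | C k =>
    have h1 : (1 : B f φ) ∈ M := by simpa using mem 0 0 0 hd
    have := M.smul_mem k h1
    rwa [← Algebra.algebraMap_eq_smul_one] at this
  | add p q hp hq => rw [map_add]; exact M.add_mem hp hq
  | mul_X p i hp =>
    rw [map_mul]
    fin_cases i
    · exact hx _ hp
    · exact hy _ hp
    · exact hz _ hp

/-- The leading exponent of a nonzero element of `B` is that of a monomial, and the element is a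
combination of monomials with exponents not below it. -/
theorem exists_leading (hf : f ≠ 0) (hφ : φ.Monic) (hd : 0 < φ.natDegree) {b : B f φ}
    (hb : b ≠ 0) :
    ∃ i, ∃ c ≠ 0, (toHahn f φ hf b).HasLeadingTerm (basisExpo f φ i) c ∧
      b ∈ Submodule.span K (basisMon f φ '' {j | basisExpo f φ i ≤ basisExpo f φ j}) := by
  refine HahnSeries.exists_hasLeadingTerm_of_span (toHahn f φ hf).toLinearMap (basisMon f φ)
    (basisExpo f φ) (fun i => f.leadingCoeff⁻¹ ^ (i.2 / φ.natDegree))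
    (fun i => pow_ne_zero _ (inv_ne_zero (leadingCoeff_ne_zero.2 hf)))
    basisExpo_injective (fun i => ?_) (by rw [span_basisMon hφ hd]; trivial) hb
  refine isLeadingRel_basisMon (R := fun b s c => (toHahn f φ hf b).HasLeadingTerm s c)
    ⟨fun c => ?_, fun s => ?_, fun h h' => ?_, fun h h' => ?_, fun h h' => ?_⟩ ?_ ?_ ?_ i
  · simpa only [AlgHom.commutes] using isLeadingRel_hasLeadingTerm.algebraMap c
  · simpa only [map_zero] using HahnSeries.HasLeadingTerm.zero s
  · simpa only [map_add] using h.add h'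
  · simpa only [map_mul] using h.mul h'
  · exact h.of_lt h'
  · simpa using hahnX_leading
  · simpa using hahnZ_leading
  · exact toHahn_y_leading hf hφ

theorem toHahn_injective (hf : f ≠ 0) (hφ : φ.Monic) (hd : 0 < φ.natDegree) :
    Function.Injective (toHahn f φ hf) := by
  rw [injective_iff_map_eq_zero]
  intro b hb
  by_contra hb0
  obtain ⟨i, c, hc, h, -⟩ := exists_leading hf hφ hd hb0
  exact h.ne_zero hc hb

theorem isDomain_B (hf : f ≠ 0) (hφ : φ.Monic) (hd : 0 < φ.natDegree) : IsDomain (B f φ) :=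
  (toHahn_injective hf hφ hd).isDomain (toHahn f φ hf).toRingHom

theorem aevalAeval_injective (hf : f ≠ 0) :
    Function.Injective (aevalAeval (R := K) (x f φ) (z f φ)) := by
  rw [injective_iff_map_eq_zero]
  intro P hP
  by_contra hP0
  have h := isLeadingRel_hasLeadingTerm.aevalAeval (K := K) hahnX_leading hahnZ_leading P
  refine h.ne_zero (leadingCoeff_ne_zero.2 (leadingCoeff_ne_zero.2 hP0)) ?_
  rw [← toHahn_x (φ := φ) hf, ← toHahn_z (φ := φ) hf, ← map_aevalAeval, hP, map_zero]

end Embedding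

/-! ### Weights and the leading part of a derivation. -/

/-- The additive function on exponents taking the value `A` at the exponent of `x` and `C` at the
exponent of `z`. -/
def weight (A C : K) (s : Expo) : K := -((ofLex s).1 * C + (ofLex s).2 * A)

theorem weight_expo (A C : K) (p q : ℤ) : weight A C (expo p q) = -(p * C + q * A) := rfl

theorem weight_add (A C : K) (s t : Expo) : weight A C (s + t) = weight A C s + weight A C t := by
  obtain ⟨p, q, rfl⟩ := exists_expo s
  obtain ⟨p', q', rfl⟩ := exists_expo t
  simp only [expo_add, weight_expo]
  push_cast
  ring

theorem weight_nsmul (A C : K) (n : ℕ) (s : Expo) : weight A C (n • s) = n * weight A C s := by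
  induction n with
  | zero => simp [weight]
  | succ n ih => rw [succ_nsmul, weight_add, ih]; push_cast; ring

section Graded

variable {f : K[X]} {φ : K[X][X]} (hf : f ≠ 0)
  (D : Derivation K (B f φ) (B f φ)) (T : Expo) (A C : K)

/-- The derivation `D` shifts the leading exponent of `b` by at least `T`, and acts on the leading
term as a homogeneous derivation of degree `T` with weights `A` and `C`. -/
def GradedRel (b : B f φ) (s : Expo) (c : K) : Prop :=
  (toHahn f φ hf b).HasLeadingTerm s c ∧
    (toHahn f φ hf (D b)).HasLeadingTerm (s + T) (weight A C s * c)

/-- Closure under products is the Leibniz rule together with additivity of the weight. -/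
theorem isLeadingRel_gradedRel : IsLeadingRel (GradedRel hf D T A C) where
  algebraMap c := by
    refine ⟨?_, ?_⟩
    · rw [AlgHom.commutes]
      exact isLeadingRel_hasLeadingTerm.algebraMap c
    · rw [Derivation.map_algebraMap, map_zero]
      simpa [weight] using HahnSeries.HasLeadingTerm.zero (0 + T)
  zero s := by
    refine ⟨?_, ?_⟩
    · rw [map_zero]
      exact HahnSeries.HasLeadingTerm.zero s
    · rw [map_zero, map_zero, mul_zero]
      exact HahnSeries.HasLeadingTerm.zero _
  add h h' := by
    refine ⟨?_, ?_⟩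
    · rw [map_add]
      exact h.1.add h'.1
    · rw [map_add, map_add, mul_add]
      exact h.2.add h'.2
  mul {a b s t c d} h h' := by
    refine ⟨?_, ?_⟩
    · rw [map_mul]
      exact h.1.mul h'.1
    · have h1 := h.1.mul h'.2
      have h2 := h'.1.mul h.2
      rw [← map_mul] at h1 h2
      rw [show s + (t + T) = s + t + T by abel] at h1
      rw [show t + (s + T) = s + t + T by abel] at h2
      have h3 := h1.add h2
      rw [Derivation.leibniz, map_add, smul_eq_mul, smul_eq_mul, weight_add]
      convert h3 using 1
      ring
  of_lt h h' := ⟨h.1.of_lt h', by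
    rw [mul_zero]
    exact h.2.of_lt (by gcongr)⟩

variable {hf D T A C}

/-- Differentiating f(x)y = φ(x,z) gives f(x) D y = D(φ(x,z)) - y D(f(x)), whose right side is
controlled by x and z; then divide by f(x). -/
theorem gradedRel_y (hφ : φ.Monic) (hx : GradedRel hf D T A C (x f φ) (expo 0 (-1)) 1)
    (hz : GradedRel hf D T A C (z f φ) (expo (-1) 0) 1) :
    GradedRel hf D T A C (y f φ) (expo (-φ.natDegree) f.natDegree) f.leadingCoeff⁻¹ := by
  have hR := isLeadingRel_gradedRel hf D T A C
  have hlc : f.leadingCoeff ≠ 0 := leadingCoeff_ne_zero.2 hf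
  have hy := toHahn_y_leading (φ := φ) hf hφ
  have h1 := hR.aeval hx f
  have h2 := hR.aevalAeval hx hz φ
  refine ⟨hy, ?_⟩
  have h3 := h2.2
  rw [← aeval_x_mul_y, hφ.leadingCoeff, natDegree_one, Derivation.leibniz, map_add, smul_eq_mul,
    smul_eq_mul, map_mul, map_mul] at h3
  have h4 := hy.mul h1.2
  have hs : expo (-φ.natDegree) f.natDegree + (expo 0 (-f.natDegree) + T) =
      expo (-φ.natDegree) (-(0 : ℕ)) + T := by
    rw [← add_assoc, expo_add]
    simp
  rw [hs] at h4
  have h5 := h3.sub h4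
  rw [add_sub_cancel_right] at h5
  have hs' : expo (-φ.natDegree) (-(0 : ℕ)) + T =
      expo 0 (-f.natDegree) + (expo (-φ.natDegree) f.natDegree + T) := by
    rw [← hs]
    abel
  rw [hs'] at h5
  have h6 := h1.1.of_mul hlc h5
  convert h6 using 1
  simp only [weight_expo, leadingCoeff_one]
  push_cast
  field_simp
  ring

/-- The element is a combination of monomials with exponents not below its own, and each monomial
inherits the relation from x, y and z. -/
theorem gradedRel_of_hasLeadingTerm (hφ : φ.Monic) (hd : 0 < φ.natDegree)
    (hx : GradedRel hf D T A C (x f φ) (expo 0 (-1)) 1)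
    (hz : GradedRel hf D T A C (z f φ) (expo (-1) 0) 1) {b : B f φ} {s : Expo} {c : K}
    (hc : c ≠ 0) (hb : (toHahn f φ hf b).HasLeadingTerm s c) : GradedRel hf D T A C b s c := by
  have hR := isLeadingRel_gradedRel hf D T A C
  have hb0 : b ≠ 0 := by
    rintro rfl
    exact hb.ne_zero hc (map_zero _)
  obtain ⟨i, c', hc', hbi, hspan⟩ := exists_leading hf hφ hd hb0
  have key : ∀ v ∈ Submodule.span K (basisMon f φ '' {j | basisExpo f φ i ≤ basisExpo f φ j}),
      ∃ e, GradedRel hf D T A C v (basisExpo f φ i) e := by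
    intro v hv
    induction hv using Submodule.span_induction with
    | mem v hv =>
      obtain ⟨j, hj, rfl⟩ := hv
      have h := isLeadingRel_basisMon hR hx hz (gradedRel_y hφ hx hz) j
      rcases (show basisExpo f φ i ≤ basisExpo f φ j from hj).eq_or_lt with he | hlt
      · exact ⟨_, he ▸ h⟩
      · exact ⟨_, hR.of_lt h hlt⟩
    | zero => exact ⟨0, hR.zero _⟩
    | add v w _ _ hv hw =>
      obtain ⟨e, he⟩ := hv
      obtain ⟨e', he'⟩ := hw
      exact ⟨_, hR.add he he'⟩
    | smul k v _ hv =>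
      obtain ⟨e, he⟩ := hv
      exact ⟨_, hR.smul k he⟩
  obtain ⟨e, he⟩ := key b hspan
  obtain rfl := hb.eq_of_ne_zero hc hbi hc'
  rwa [hb.unique he.1]

/-- The coefficient of D^n b at s + nT is c times the product of weight(s) + j weight(T) over j < n,
so D^n b = 0 forces a factor to vanish. -/
theorem exists_weight_eq_zero (hφ : φ.Monic) (hd : 0 < φ.natDegree)
    (hx : GradedRel hf D T A C (x f φ) (expo 0 (-1)) 1)
    (hz : GradedRel hf D T A C (z f φ) (expo (-1) 0) 1) {b : B f φ} {s : Expo} {c : K}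
    (hc : c ≠ 0) (hb : (toHahn f φ hf b).HasLeadingTerm s c) (hnil : ∃ n : ℕ, (⇑D)^[n] b = 0) :
    ∃ j : ℕ, weight A C s + j * weight A C T = 0 := by
  by_contra! hne
  have key : ∀ j : ℕ, ∃ e ≠ 0, (toHahn f φ hf ((⇑D)^[j] b)).HasLeadingTerm (s + j • T) e := by
    intro j
    induction j with
    | zero => exact ⟨c, hc, by simpa using hb⟩
    | succ j ih =>
      obtain ⟨e, he, h⟩ := ih
      refine ⟨weight A C (s + j • T) * e, ?_, ?_⟩
      · rw [weight_add, weight_nsmul]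
        exact mul_ne_zero (hne j) he
      · rw [Function.iterate_succ_apply', succ_nsmul, ← add_assoc]
        exact (gradedRel_of_hasLeadingTerm hφ hd hx hz he h).2
  obtain ⟨n, hn⟩ := hnil
  obtain ⟨e, he, h⟩ := key n
  exact h.ne_zero he (by rw [hn, map_zero])

end Graded

/-! ### The exponent semigroup and the structure of locally nilpotent derivations. -/

/-- The exponents of nonzero elements of `B` lie in the semigroup generated by those of
`x`, `y` and `z`. -/
theorem expo_bounds {f : K[X]} {φ : K[X][X]} (hf : f ≠ 0) (hφ : φ.Monic) (hd : 0 < φ.natDegree)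
    {b : B f φ} {p q : ℤ} {c : K} (hc : c ≠ 0)
    (hb : (toHahn f φ hf b).HasLeadingTerm (expo p q) c) :
    p ≤ 0 ∧ q ≤ f.natDegree * (-p / φ.natDegree) := by
  have hb0 : b ≠ 0 := by
    rintro rfl
    exact hb.ne_zero hc (map_zero _)
  obtain ⟨i, c', hc', hbi, -⟩ := exists_leading hf hφ hd hb0
  have h := hb.eq_of_ne_zero hc hbi hc'
  unfold basisExpo at h
  rw [expo_inj] at h
  obtain ⟨rfl, rfl⟩ := h
  refine ⟨by simp, ?_⟩
  rw [neg_neg]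
  push_cast
  linarith [Int.natCast_nonneg i.1]

/-- Here (-p, -q) is the shift T, and a, c, e are the weights of x, z, y in units of -weight(T). The
bounds say that the exponents of D x and D z lie in the semigroup of B. -/
theorem semigroup_shift {m d a c e : ℕ} (hm : 2 ≤ m) (hd : 2 ≤ d) {p q : ℤ}
    (h1 : m * a + e = d * c) (h2 : p * c + q * a = -1)
    (h3 : 0 < a → 0 ≤ p ∧ -1 - q ≤ m * (p / d)) (h4 : 0 < c → -q ≤ m * ((p + 1) / d)) :
    a = 0 := by
  by_contra ha
  have ha : 0 < a := Nat.pos_of_ne_zero ha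
  have hc : 0 < c := by
    rcases Nat.eq_zero_or_pos c with rfl | h
    · have : 0 < m * a := Nat.mul_pos (by omega) ha
      omega
    · exact h
  obtain ⟨hp, hx⟩ := h3 ha
  have hz := h4 hc
  have hd0 : (0 : ℤ) < d := by omega
  obtain ⟨P, r, hr0, hr, rfl⟩ : ∃ P r : ℤ, 0 ≤ r ∧ r < d ∧ p = d * P + r :=
    ⟨p / d, p % d, Int.emod_nonneg _ hd0.ne', Int.emod_lt_of_pos _ hd0,
      (Int.mul_ediv_add_emod _ _).symm⟩
  have e1 : (d * P + r) / d = P := by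
    rw [Int.mul_add_ediv_left _ _ hd0.ne', Int.ediv_eq_zero_of_lt hr0 hr, add_zero]
  rw [e1] at hx
  -- Eliminating c leaves a sum equal to -d, while both summands turn out to be nonnegative.
  have key : (a : ℤ) * (d * (m * P + q) + r * m) + (d * P + r) * e = -d := by
    zify at h1
    linear_combination d * h2 + (d * P + r) * h1
  have hpe : 0 ≤ (d * P + r) * (e : ℤ) := mul_nonneg hp (by positivity)
  have hpos : 0 ≤ d * (m * P + q) + r * m := by
    rcases lt_or_ge (r + 1) (d : ℤ) with h | h
    · have e2 : (d * P + r + 1) / d = P := by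
        rw [add_assoc, Int.mul_add_ediv_left _ _ hd0.ne',
          Int.ediv_eq_zero_of_lt (by omega) h, add_zero]
      rw [e2] at hz
      have : 0 ≤ m * P + q := by linarith
      positivity
    -- Here only mP + q ≥ -1 is known; the expression is at least (d-1)(m-1) - 1, which is
    -- nonnegative because m, d ≥ 2.
    · have hrd : r = d - 1 := by omega
      have hQ : -1 ≤ m * P + q := by linarith
      have hm' : (2 : ℤ) ≤ m := by exact_mod_cast hm
      have hd' : (2 : ℤ) ≤ d := by exact_mod_cast hd
      subst hrd
      nlinarith [mul_nonneg hd0.le (by linarith : 0 ≤ m * P + q + 1),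
        mul_nonneg (by linarith : (0 : ℤ) ≤ d - 1) (by linarith : (0 : ℤ) ≤ m - 2)]
  have : 0 ≤ (a : ℤ) * (d * (m * P + q) + r * m) := mul_nonneg (by positivity) hpos
  linarith

open HahnSeries in
/-- Two series, not both zero, have leading terms at simultaneous shifts of given exponents. -/
theorem exists_common_shift {u v : HahnSeries Expo K} (h : u ≠ 0 ∨ v ≠ 0) (g k : Expo) :
    ∃ T a c, u.HasLeadingTerm (g + T) a ∧ v.HasLeadingTerm (k + T) c ∧ (a ≠ 0 ∨ c ≠ 0) := by
  have aux : ∀ (u v : HahnSeries Expo K) (g k : Expo), u ≠ 0 →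
      (v ≠ 0 → u.order - g ≤ v.order - k) →
      ∃ T a c, u.HasLeadingTerm (g + T) a ∧ v.HasLeadingTerm (k + T) c ∧ (a ≠ 0 ∨ c ≠ 0) := by
    intro u v g k hu hv
    have hu' : u.HasLeadingTerm (g + (u.order - g)) u.leadingCoeff := by
      rw [add_sub_cancel]
      exact HasLeadingTerm.of_ne_zero hu
    by_cases hv0 : v = 0
    · exact ⟨_, _, 0, hu', hv0 ▸ HasLeadingTerm.zero _, Or.inl (leadingCoeff_ne_zero.2 hu)⟩
    · rcases (hv hv0).eq_or_lt with he | hlt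
      · refine ⟨_, _, v.leadingCoeff, hu', ?_, Or.inl (leadingCoeff_ne_zero.2 hu)⟩
        rw [he, add_sub_cancel]
        exact HasLeadingTerm.of_ne_zero hv0
      · refine ⟨_, _, 0, hu', ?_, Or.inl (leadingCoeff_ne_zero.2 hu)⟩
        exact (HasLeadingTerm.of_ne_zero hv0).of_lt (lt_sub_iff_add_lt'.1 hlt)
  by_cases hu : u = 0
  · obtain ⟨T, c, a, hc, ha, hne⟩ := aux v u k g (h.resolve_left (not_not.2 hu)) (absurd hu)
    exact ⟨T, a, c, ha, hc, hne.symm⟩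
  by_cases hv : v = 0
  · exact aux u v g k hu (absurd hv)
  rcases le_total (u.order - g) (v.order - k) with hle | hle
  · exact aux u v g k hu fun _ => hle
  · obtain ⟨T, c, a, hc, ha, hne⟩ := aux v u k g hv fun _ => hle
    exact ⟨T, a, c, ha, hc, hne.symm⟩

/-- A derivation of `B` is determined by its values on `x` and `z`. -/
theorem derivation_ext {f : K[X]} {φ : K[X][X]} (hf : f ≠ 0) (hφ : φ.Monic)
    (hd : 0 < φ.natDegree) {D D' : Derivation K (B f φ) (B f φ)} (hx : D (x f φ) = D' (x f φ))
    (hz : D (z f φ) = D' (z f φ)) : D = D' := by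
  have := isDomain_B hf hφ hd
  rw [← sub_eq_zero]
  set E := D - D' with hE
  have ex : E (x f φ) = 0 := by simp [hE, hx]
  have ez : E (z f φ) = 0 := by simp [hE, hz]
  have hfx : aeval (x f φ) f ≠ 0 := by
    intro h
    have h' := isLeadingRel_hasLeadingTerm.aeval (K := K) hahnX_leading f
    refine h'.ne_zero (leadingCoeff_ne_zero.2 hf) ?_
    rw [← toHahn_x (φ := φ) hf, aeval_algHom_apply, h, map_zero]
  -- The relation gives f(x) E(y) = 0, and B is a domain.
  have ey : E (y f φ) = 0 := by
    have h := congrArg E (aeval_x_mul_y f φ)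
    rw [Derivation.leibniz, Derivation.map_aeval, derivation_aevalAeval E _ _ ex, ex, ez] at h
    simpa [hfx] using h
  ext b
  rw [Derivation.zero_apply]
  obtain ⟨p, rfl⟩ := Ideal.Quotient.mk_surjective b
  induction p using MvPolynomial.induction_on with
  | C k => exact E.map_algebraMap k
  | add p q hp hq => rw [map_add, map_add, hp, hq, add_zero]
  | mul_X p i hp =>
    have hi : E (Ideal.Quotient.mk _ (MvPolynomial.X i)) = 0 := by
      fin_cases i
      · exact ex
      · exact ey
      · exact ez
    rw [map_mul, Derivation.leibniz, hp, hi, smul_zero, smul_zero, add_zero]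

/-- Elements of small degree in `z` are polynomials in `x` and `z`. -/
theorem exists_eq_aevalAeval {f : K[X]} {φ : K[X][X]} (hf : f ≠ 0) (hφ : φ.Monic)
    (hd : 0 < φ.natDegree) {b : B f φ} {N : ℕ} (hN : N < φ.natDegree) {q : ℤ} {c : K} (hc : c ≠ 0)
    (hb : (toHahn f φ hf b).HasLeadingTerm (expo (-N) q) c) :
    ∃ P : K[X][X], P.natDegree ≤ N ∧ b = aevalAeval (x f φ) (z f φ) P := by
  have hb0 : b ≠ 0 := by
    rintro rfl
    exact hb.ne_zero hc (map_zero _)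
  obtain ⟨i, c', hc', hbi, hspan⟩ := exists_leading hf hφ hd hb0
  have h := hb.eq_of_ne_zero hc hbi hc'
  rw [← h] at hspan
  clear hb0 h hbi hb
  induction hspan using Submodule.span_induction with
  | mem v hv =>
    obtain ⟨j, hj, rfl⟩ := hv
    -- These monomials have z-degree at most N < d, so y, which has z-degree d, does not occur.
    rw [Set.mem_ofPred_eq, basisExpo, expo_le] at hj
    have hjN : j.2 ≤ N := by omega
    refine ⟨C (X ^ j.1) * X ^ j.2, (natDegree_C_mul_X_pow_le _ _).trans hjN, ?_⟩
    rw [map_mul, map_pow _ _ j.2, aevalAeval_C, aevalAeval_Y, basisMon,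
      Nat.div_eq_of_lt (hjN.trans_lt hN), Nat.mod_eq_of_lt (hjN.trans_lt hN)]
    simp
  | zero => exact ⟨0, by simp, by simp⟩
  | add v w _ _ hv hw =>
    obtain ⟨P, hP, rfl⟩ := hv
    obtain ⟨Q, hQ, rfl⟩ := hw
    exact ⟨P + Q, natDegree_add_le_of_degree_le hP hQ, (map_add _ _ _).symm⟩
  | smul k v _ hv =>
    obtain ⟨P, hP, rfl⟩ := hv
    exact ⟨k • P, (natDegree_smul_le _ _).trans hP, (map_smul _ _ _).symm⟩

theorem exists_eq_aeval {f : K[X]} {φ : K[X][X]} (hf : f ≠ 0) (hφ : φ.Monic)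
    (hd : 0 < φ.natDegree) {b : B f φ} {q : ℤ} {c : K} (hc : c ≠ 0)
    (hb : (toHahn f φ hf b).HasLeadingTerm (expo 0 q) c) :
    ∃ g : K[X], b = aeval (x f φ) g := by
  obtain ⟨P, hP, rfl⟩ := exists_eq_aevalAeval hf hφ hd (N := 0) hd hc (by simpa using hb)
  rw [Nat.le_zero] at hP
  rw [eq_C_of_natDegree_eq_zero hP]
  exact ⟨_, aevalAeval_C _ _ _⟩

theorem mem_adjoin_x {f : K[X]} {φ : K[X][X]} {b : B f φ} :
    b ∈ Algebra.adjoin K {x f φ} ↔ ∃ g : K[X], b = aeval (x f φ) g := by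
  rw [Algebra.adjoin_singleton_eq_range_aeval]
  simp [eq_comm]

/-- A nonzero locally nilpotent `K`-derivation of `B` kills exactly `K[x]` and maps `z` into
`K[x]`. -/
theorem structure_of_locally_nilpotent [CharZero K] {f : K[X]} (hf : 1 < f.natDegree)
    {φ : K[X][X]} (hφ : φ.Monic) (hd : 1 < φ.natDegree) {D : Derivation K (B f φ) (B f φ)}
    (hD : D ≠ 0) (hnil : ∀ b, ∃ n : ℕ, (⇑D)^[n] b = 0) :
    D (x f φ) = 0 ∧ (∃ g : K[X], g ≠ 0 ∧ D (z f φ) = aeval (x f φ) g) ∧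
      ∀ b, D b = 0 → ∃ g : K[X], b = aeval (x f φ) g := by
  have hf0 : f ≠ 0 := ne_zero_of_natDegree_gt hf
  have hd0 : 0 < φ.natDegree := by omega
  have hinj := toHahn_injective (φ := φ) hf0 hφ hd0
  have hne : toHahn f φ hf0 (D (x f φ)) ≠ 0 ∨ toHahn f φ hf0 (D (z f φ)) ≠ 0 := by
    by_contra! h
    rw [map_eq_zero_iff _ hinj, map_eq_zero_iff _ hinj] at h
    exact hD (derivation_ext hf0 hφ hd0 (by simpa using h.1) (by simpa using h.2))
  obtain ⟨T, A, C, hA, hC, hAC⟩ := exists_common_shift hne (expo 0 (-1)) (expo (-1) 0)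
  have hx : GradedRel hf0 D T A C (x f φ) (expo 0 (-1)) 1 :=
    ⟨by simpa using hahnX_leading, by simpa [weight_expo] using hA⟩
  have hz : GradedRel hf0 D T A C (z f φ) (expo (-1) 0) 1 :=
    ⟨by simpa using hahnZ_leading, by simpa [weight_expo] using hC⟩
  have hy := gradedRel_y hφ hx hz
  obtain ⟨a, ha⟩ := exists_weight_eq_zero hφ hd0 hx hz one_ne_zero hx.1 (hnil _)
  obtain ⟨c, hc⟩ := exists_weight_eq_zero hφ hd0 hx hz one_ne_zero hz.1 (hnil _)
  obtain ⟨e, he⟩ := exists_weight_eq_zero hφ hd0 hx hz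
    (inv_ne_zero (leadingCoeff_ne_zero.2 hf0)) hy.1 (hnil _)
  obtain ⟨p, q, rfl⟩ := exists_expo T
  rw [expo_add] at hA hC
  -- The weights of x, z and y are aθ, cθ and eθ. Since A and C are not both zero, θ ≠ 0, and
  -- dividing by θ turns the weight identities into integer ones, by characteristic zero.
  set θ := -weight A C (expo p q) with hθ
  have hw : weight A C (expo p q) = -θ := (neg_neg _).symm
  rw [hw] at ha hc he
  simp only [weight_expo] at ha hc he hw
  push_cast at ha hc he
  have hAa : A = a * θ := by linear_combination ha
  have hCc : C = c * θ := by linear_combination hc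
  have hθ0 : θ ≠ 0 := by
    intro h0
    rw [h0, mul_zero] at hAa hCc
    exact hAC.elim (fun h => h hAa) (fun h => h hCc)
  have h1 : f.natDegree * a + e = φ.natDegree * c := by
    have : ((f.natDegree * a + e : ℕ) : K) = (φ.natDegree * c : ℕ) := by
      apply mul_right_cancel₀ hθ0
      push_cast
      rw [hAa, hCc] at he
      linear_combination -he
    exact_mod_cast this
  have h2 : p * c + q * a = 1 := by
    have : ((p * c + q * a : ℤ) : K) = (1 : ℤ) := by
      apply mul_right_cancel₀ hθ0
      push_cast
      rw [hAa, hCc] at hw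
      linear_combination -hw
    exact_mod_cast this
  have ha0 : a = 0 := by
    refine semigroup_shift (p := -p) (q := -q) hf hd h1 (by linarith) (fun hpos => ?_)
      (fun hpos => ?_)
    · have hA0 : A ≠ 0 := hAa ▸ mul_ne_zero (Nat.cast_ne_zero.2 hpos.ne') hθ0
      have := expo_bounds hf0 hφ hd0 hA0 hA
      rw [zero_add] at this
      exact ⟨by linarith, by linarith⟩
    · have hC0 : C ≠ 0 := hCc ▸ mul_ne_zero (Nat.cast_ne_zero.2 hpos.ne') hθ0
      have := (expo_bounds hf0 hφ hd0 hC0 hC).2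
      rw [show -(-1 + p) = -p + 1 by ring] at this
      linarith
  subst ha0
  rw [Nat.cast_zero, zero_mul] at hAa
  subst hAa
  have hC0 : C ≠ 0 := hAC.resolve_left (not_not.2 rfl)
  -- With a = 0 the shift identity is pc = 1 with c natural.
  obtain rfl : p = 1 := by
    rw [Nat.cast_zero, mul_zero, add_zero] at h2
    rcases Int.eq_one_or_neg_one_of_mul_eq_one h2 with h | h
    · exact h
    · subst h
      omega
  refine ⟨?_, ?_, fun b hb => ?_⟩
  -- A nonzero D x would have leading exponent with first component at least 1, but these components
  -- are never positive in B.
  · by_contra hDx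
    have hDx' : toHahn f φ hf0 (D (x f φ)) ≠ 0 := (map_ne_zero_iff _ hinj).2 hDx
    have hle := hA.le_order hDx'
    have hlead := HahnSeries.HasLeadingTerm.of_ne_zero hDx'
    obtain ⟨r, s, hrs⟩ := exists_expo (toHahn f φ hf0 (D (x f φ))).order
    rw [hrs] at hle hlead
    have := (expo_bounds hf0 hφ hd0 (HahnSeries.leadingCoeff_ne_zero.2 hDx') hlead).1
    rw [expo_le] at hle
    omega
  · obtain ⟨g, hg⟩ := exists_eq_aeval hf0 hφ hd0 hC0 hC
    refine ⟨g, ?_, hg⟩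
    rintro rfl
    exact hC.ne_zero hC0 (by rw [hg, map_zero, map_zero])
  · by_cases hb0 : b = 0
    · exact ⟨0, by rw [hb0, map_zero]⟩
    obtain ⟨i, e, he, hlead, -⟩ := exists_leading hf0 hφ hd0 hb0
    have h := (gradedRel_of_hasLeadingTerm hφ hd0 hx hz he hlead).2
    rw [hb, map_zero] at h
    have h0 := h.unique (HahnSeries.HasLeadingTerm.zero _)
    unfold basisExpo at h0 hlead
    rw [weight_expo] at h0
    -- As A = 0, the weight is i.2 times C, so it vanishes only in z-degree 0.
    have hi : i.2 = 0 := by simpa [he, hC0] using h0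
    refine exists_eq_aeval hf0 hφ hd0 he (q := f.natDegree * (i.2 / φ.natDegree : ℕ) - i.1) ?_
    simpa [hi] using hlead

/-! ### Values of 𝒟 and linearity over K. -/

section Values

variable (f : K[X]) (φ : K[X][X])

theorem 𝒟_x : 𝒟 f φ (x f φ) = 0 := by
  have h := Derivation.liftOfSurjective_apply
    (f := Ideal.Quotient.mkₐ K (Ideal.span {equation f φ}))
    (Ideal.Quotient.mkₐ_surjective K _) (d := polyDer f φ) (polyDer_mem f φ) (MvPolynomial.X 0)
  refine h.trans ?_
  simp [polyDer, MvPolynomial.mkDerivation_X]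

theorem 𝒟_y : 𝒟 f φ (y f φ) = aevalAeval (x f φ) (z f φ) (derivative φ) := by
  have h := Derivation.liftOfSurjective_apply
    (f := Ideal.Quotient.mkₐ K (Ideal.span {equation f φ}))
    (Ideal.Quotient.mkₐ_surjective K _) (d := polyDer f φ) (polyDer_mem f φ) (MvPolynomial.X 1)
  refine h.trans ?_
  rw [polyDer, MvPolynomial.mkDerivation_X]
  exact map_aevalAeval _ _ _ _

theorem 𝒟_z : 𝒟 f φ (z f φ) = aeval (x f φ) f := by
  have h := Derivation.liftOfSurjective_apply
    (f := Ideal.Quotient.mkₐ K (Ideal.span {equation f φ}))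
    (Ideal.Quotient.mkₐ_surjective K _) (d := polyDer f φ) (polyDer_mem f φ) (MvPolynomial.X 2)
  refine h.trans ?_
  rw [polyDer, MvPolynomial.mkDerivation_X]
  exact (aeval_algHom_apply _ _ _).symm

end Values

/-- A derivation killing the constants is linear over them. -/
theorem exists_restrictScalars_eq {A : Type*} [CommRing A] [Algebra K A] (D : Derivation ℤ A A)
    (h : ∀ k : K, D (algebraMap K A k) = 0) :
    ∃ D' : Derivation K A A, D'.restrictScalars ℤ = D := by
  refine ⟨Derivation.mk'
    { toFun := D, map_add' := map_add D, map_smul' := fun k a => ?_ } D.leibniz, ?_⟩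
  · rw [Algebra.smul_def, Derivation.leibniz, h, smul_zero, add_zero, smul_eq_mul,
      RingHom.id_apply, Algebra.smul_def]
  · ext a
    rfl

/-- Locally nilpotent derivations of a domain over a field of characteristic zero are linear over
that field. -/
theorem exists_linear_of_mem_LND [CharZero K] {A : Type*} [CommRing A] [IsDomain A] [Algebra K A]
    {D : Derivation ℤ A A} (hD : D ∈ LND A) :
    ∃ D' : Derivation K A A, D' ≠ 0 ∧ D'.restrictScalars ℤ = D := by
  have : CharZero A := charZero_of_injective_algebraMap (algebraMap K A).injective
  obtain ⟨D', hD'⟩ := exists_restrictScalars_eq (K := K) D fun k => by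
    by_cases hk : k = 0
    · rw [hk, map_zero, map_zero]
    · exact Derivation.apply_eq_zero_of_mul_eq_one hD.2 (b := algebraMap K _ k⁻¹) (by
        rw [← map_mul, mul_inv_cancel₀ hk, map_one])
  refine ⟨D', ?_, hD'⟩
  rintro rfl
  exact hD.1 (hD'.symm.trans (by ext; rfl))

/-! ### Divisibility by f and the two inclusions. -/

variable {f : K[X]} {φ : K[X][X]}

theorem aeval_x_injective (hf : f ≠ 0) : Function.Injective (aeval (R := K) (x f φ)) := by
  intro p q h
  refine C_injective (aevalAeval_injective (φ := φ) hf ?_)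
  rwa [aevalAeval_C, aevalAeval_C]

/-- If `D x = 0` and `D z = g(x)`, then `f` divides `g`. -/
theorem dvd_of_apply_z [CharZero K] (hf : f ≠ 0) (hφ : φ.Monic) (hd : 0 < φ.natDegree)
    {D : Derivation K (B f φ) (B f φ)} (hx : D (x f φ) = 0) {g : K[X]} (hg : g ≠ 0)
    (hz : D (z f φ) = aeval (x f φ) g) : f ∣ g := by
  have hrel : aeval (x f φ) f * D (y f φ) =
      aevalAeval (x f φ) (z f φ) (derivative φ * C g) := by
    have h := congrArg D (aeval_x_mul_y f φ)
    rw [Derivation.leibniz, Derivation.map_aeval, derivation_aevalAeval D _ _ hx, hx, hz,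
      smul_zero, smul_zero, add_zero, smul_eq_mul] at h
    rw [h, map_mul, aevalAeval_C]
  have hder : derivative φ * C g ≠ 0 := by
    refine mul_ne_zero (fun h => ?_) (C_ne_zero.2 hg)
    exact hd.ne' (derivative_eq_zero.1 h)
  have hdeg : (derivative φ * C g).natDegree < φ.natDegree :=
    (natDegree_mul_C_le _ _).trans_lt (natDegree_derivative_lt hd.ne')
  have hlc := leadingCoeff_ne_zero.2 (leadingCoeff_ne_zero.2 hder)
  have h1 := isLeadingRel_hasLeadingTerm.aeval (K := K) hahnX_leading f
  have h2 := isLeadingRel_hasLeadingTerm.aevalAeval (K := K) hahnX_leading hahnZ_leading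
    (derivative φ * C g)
  rw [← toHahn_x (φ := φ) hf] at h1 h2
  rw [← toHahn_z (φ := φ) hf, ← map_aevalAeval, ← hrel, map_mul, ← aeval_algHom_apply] at h2
  set N := (derivative φ * C g).natDegree with hN
  set k := (derivative φ * C g).leadingCoeff.natDegree
  have h3 := h1.of_mul (leadingCoeff_ne_zero.2 hf) (h := expo (-N) (f.natDegree - k)) (by
    rw [expo_add]
    rwa [zero_add, neg_add_eq_sub, sub_sub_cancel_left])
  have hlc' := mul_ne_zero (inv_ne_zero (leadingCoeff_ne_zero.2 hf)) hlc
  -- As f(x) D y has z-degree below d, so does D y, which is therefore a polynomial in x and z.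
  obtain ⟨P, -, hP⟩ := exists_eq_aevalAeval hf hφ hd hdeg
    hlc' h3
  rw [hP, ← aevalAeval_C (R := K) (x f φ) (z f φ) f, ← map_mul] at hrel
  -- As φ is monic, the coefficient of Z^(d-1) in φ_Z g is d·g, and d is a unit of K.
  have hc := congrArg (fun Q => coeff Q (φ.natDegree - 1)) (aevalAeval_injective hf hrel)
  simp only [coeff_C_mul, coeff_mul_C, coeff_derivative] at hc
  rw [Nat.sub_add_cancel hd, hφ.coeff_natDegree, one_mul] at hc
  have hunit : IsUnit (((φ.natDegree - 1 : ℕ) : K[X]) + 1) := by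
    have : (((φ.natDegree - 1 : ℕ) : K[X]) + 1) = C (φ.natDegree : K) := by
      rw [← Nat.cast_succ, Nat.succ_eq_add_one, Nat.sub_add_cancel hd, map_natCast]
    rw [this, isUnit_C]
    exact (Nat.cast_ne_zero.2 hd.ne').isUnit
  exact (hunit.dvd_mul_left).1 ⟨_, hc.symm⟩

theorem exists_eq_smul [CharZero K] (hf : 1 < f.natDegree) (hφ : φ.Monic) (hd : 1 < φ.natDegree)
    {D : Derivation K (B f φ) (B f φ)} (hD : D ≠ 0) (hnil : ∀ b, ∃ n : ℕ, (⇑D)^[n] b = 0) :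
    ∃ h : K[X], h ≠ 0 ∧ D = aeval (x f φ) h • 𝒟 f φ := by
  have hf0 : f ≠ 0 := ne_zero_of_natDegree_gt hf
  have hd0 : 0 < φ.natDegree := by omega
  obtain ⟨hx, ⟨g, hg, hz⟩, -⟩ := structure_of_locally_nilpotent hf hφ hd hD hnil
  obtain ⟨h, rfl⟩ := dvd_of_apply_z hf0 hφ hd0 hx hg hz
  refine ⟨h, right_ne_zero_of_mul hg, derivation_ext hf0 hφ hd0 ?_ ?_⟩
  · rw [Derivation.smul_apply, 𝒟_x, hx, smul_zero]
  · rw [Derivation.smul_apply, 𝒟_z, hz, map_mul, smul_eq_mul, mul_comm]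

/-- The nilpotent elements form a subring. It contains K[x], which is killed, then z, whose image
lies in K[x], then y, whose image lies in K[x, z]. -/
theorem smul_𝒟_mem_LND (hf : f ≠ 0) (hφ : φ.Monic) (hd : 0 < φ.natDegree) {h : K[X]}
    (hh : h ≠ 0) : aeval (x f φ) h • (𝒟 f φ).restrictScalars ℤ ∈ LND (B f φ) := by
  have := isDomain_B hf hφ hd
  set D := aeval (x f φ) h • 𝒟 f φ with hD
  have hDb : ∀ b, D b = aeval (x f φ) h * 𝒟 f φ b := fun b => rfl
  have h0 : ∀ {g : K[X]}, g ≠ 0 → aeval (x f φ) g ≠ 0 := fun hg =>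
    (map_ne_zero_iff _ (aeval_x_injective hf)).2 hg
  refine ⟨fun hzero => ?_, fun a => ?_⟩
  · have h1 : aeval (x f φ) h * 𝒟 f φ (z f φ) = 0 := DFunLike.congr_fun hzero (z f φ)
    rw [𝒟_z] at h1
    exact mul_ne_zero (h0 hh) (h0 hf) h1
  have hconst : ∀ g : K[X], aeval (x f φ) g ∈ Derivation.nilSubring D := fun g =>
    ⟨1, by rw [Function.iterate_one, hDb, Derivation.map_aeval, 𝒟_x, smul_zero, mul_zero]⟩
  have hx : x f φ ∈ Derivation.nilSubring D := by simpa using hconst X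
  have hz : z f φ ∈ Derivation.nilSubring D := Derivation.mem_nilSubring_of_apply (by
    rw [hDb, 𝒟_z]
    exact mul_mem (hconst h) (hconst f))
  have hy : y f φ ∈ Derivation.nilSubring D := Derivation.mem_nilSubring_of_apply (by
    rw [hDb, 𝒟_y, aevalAeval_eq_sum]
    exact mul_mem (hconst h) (sum_mem fun i _ => mul_mem (hconst _) (pow_mem hz i)))
  change a ∈ Derivation.nilSubring D
  obtain ⟨p, rfl⟩ := Ideal.Quotient.mk_surjective a
  induction p using MvPolynomial.induction_on with
  | C k =>
    have := hconst (C k)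
    rwa [aeval_C] at this
  | add p q hp hq => rw [map_add]; exact add_mem hp hq
  | mul_X p i hp =>
    rw [map_mul]
    refine mul_mem hp ?_
    fin_cases i
    · exact hx
    · exact hy
    · exact hz

end Danielewski

end

theorem mainTheorem3 {K : Type*} [Field K] [IsAlgClosed K] [CharZero K]
    (f : K[X]) (hf : 1 < f.natDegree)
    (φ : K[X][X]) (hφ : φ.Monic) (hd : 1 < φ.natDegree) :
    (Danielewski.𝒟 f φ (Danielewski.x f φ) = 0 ∧
      Danielewski.𝒟 f φ (Danielewski.y f φ) =
        aevalAeval (Danielewski.x f φ) (Danielewski.z f φ) (derivative φ) ∧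
      Danielewski.𝒟 f φ (Danielewski.z f φ) = aeval (Danielewski.x f φ) f) ∧
    LND (Danielewski.B f φ) =
      {D | ∃ h ∈ Algebra.adjoin K {Danielewski.x f φ}, h ≠ 0 ∧
        D = h • (Danielewski.𝒟 f φ).restrictScalars ℤ} ∧
    ∀ D ∈ LND (Danielewski.B f φ),
      derivationKer D = (Algebra.adjoin K {Danielewski.x f φ} : Set (Danielewski.B f φ)) := by
  have hf0 : f ≠ 0 := ne_zero_of_natDegree_gt hf
  have hd0 : 0 < φ.natDegree := by omega
  have := Danielewski.isDomain_B hf0 hφ hd0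
  refine ⟨⟨Danielewski.𝒟_x f φ, Danielewski.𝒟_y f φ, Danielewski.𝒟_z f φ⟩, ?_, ?_⟩
  · ext D
    constructor
    · intro hD
      obtain ⟨D', hD', rfl⟩ := Danielewski.exists_linear_of_mem_LND (K := K) hD
      obtain ⟨h, hh, rfl⟩ := Danielewski.exists_eq_smul hf hφ hd hD' hD.2
      refine ⟨_, Danielewski.mem_adjoin_x.2 ⟨h, rfl⟩, ?_, by ext; rfl⟩
      exact (map_ne_zero_iff _ (Danielewski.aeval_x_injective hf0)).2 hh
    · rintro ⟨_, hmem, hh, rfl⟩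
      obtain ⟨h, rfl⟩ := Danielewski.mem_adjoin_x.1 hmem
      refine Danielewski.smul_𝒟_mem_LND hf0 hφ hd0 ?_
      rintro rfl
      exact hh (map_zero _)
  · intro D hD
    obtain ⟨D', hD', rfl⟩ := Danielewski.exists_linear_of_mem_LND (K := K) hD
    obtain ⟨hx, -, hker⟩ := Danielewski.structure_of_locally_nilpotent hf hφ hd hD' hD.2
    ext b
    rw [SetLike.mem_coe, Danielewski.mem_adjoin_x]
    refine ⟨hker b, ?_⟩
    rintro ⟨g, rfl⟩
    change D' _ = 0
    rw [Derivation.map_aeval, hx, smul_zero]
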